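/- **Setting.** Let $U\subseteq E^4$ be open, with orthonormal coordinates $x^1,\dots,x^4$ (basis $v_1,\dots,v_4$), and let $e_{a\dot b}$ be the basis of $E^4\otimes\mathbb C$ with $v_1=e_{1\dot1}+e_{2\dot2}$, $v_2=ie_{1\dot1}-ie_{2\dot2}$, $v_3=e_{1\dot2}-e_{2\dot1}$, $v_4=ie_{1\dot2}+ie_{2\dot1}$; $\partial_{a\dot b}$ denotes the derivative along $e_{a\dot b}$. Superfunctions on the part of $E^{4|8}$ over $U$ are the elements of $C^\infty(U,\mathbb C)\otimes\Lambda[\theta^{a(i)},\bar\theta^{\dot a(i)},\eta^1,\dots,\eta^N]$, $a,\dot a,i\in\{1,2\}$, where $\eta^1,\dots,\eta^N$ ($N\ge0$) are auxiliary odd parameters. Put $$D_a^{(i)}=\partial_{a(i)}-\bar\theta^{\dot b(i)}\partial_{a\dot b},\qquad \bar D_{\dot a}^{(i)}=\bar\partial_{\dot a(i)}-\theta^{b(i)}\partial_{b\dot a},$$ so that the only non-zero anticommutators of these fields are $\{D_a^{(i)},\bar D_{\dot b}^{(j)}\}=-2\delta^{ij}\partial_{a\dot b}$. Let $\mathcal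 A$ be a superconnection on a trivialised principal $SU(2)$-bundle over this superspace: its components along $\partial_{x^m}$ (even) and along $D_a^{(i)},\bar D_{\dot a}^{(i)}$ (odd) are trace-free $2\times2$ matrices of superfunctions, and the underlying ordinary connection is $\mathfrak{su}(2)$-valued. Let $\mathcal D_a^{(i)},\bar{\mathcal D}_{\dot a}^{(i)}$ be the horizontal lifts (covariant derivatives on sections of the associated $\mathbb C^2$-bundle), and for odd $X,Y$ let $$F(X,Y)=X\mathcal A(Y)+Y\mathcal A(X)+\mathcal A(X)\mathcal A(Y)+\mathcal A(Y)\mathcal A(X)-\mathcal A(\{X,Y\})$$ be the curvature. Put $\Sigma=F(\bar D_{\dot1}^{(2)},\bar D_{\dot2}^{(1)})$ and $\bar\Sigma=F(D_1^{(2)},D_2^{(1)})$. The connection is *semi-constrained* if these are its only two independent odd–odd curvatures, i.e. (with $\epsilon_{12}=1=-\epsilon_{21}$) $$F(D_a^{(i)},\bar D_{\dot b}^{(j)})=0,\qquad F(D_a^{(i)},D_b^{(j)})=-\epsilon_{ab}\epsilon_{ij}\bar\Sigma,\qquad F(\bar D_{\dot a}^{(i)},\bar D_{\dot b}^{(j)})=-\epsilon_{\dot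 a\dot b}\epsilon_{ij}\Sigma .$$ Let $i^*$ be restriction to the even part (all $\theta,\bar\theta$ set to $0$), and let $\sigma=i^*\Sigma$, $\bar\sigma=i^*\bar\Sigma$ be the flat-space scalars. **Twist.** The twist turns the copy label $(i)$ into a spinor index of $S^+$: write $D^a_b=D_b^{(a)}$, and for $\bar D^a_{\dot b}$ take either $\bar D^a_{\dot b}=\bar D_{\dot b}^{(a)}$ (the label is used as it stands) or $\bar D^a_{\dot b}=\sum_i\epsilon_{ai}\bar D_{\dot b}^{(i)}$ (the label is raised with $\epsilon$). Put $D_0=D^1_1+D^2_2$ and $$D_1=(\bar D^1_{\dot2}-\bar D^2_{\dot1})\,dv^1+(-i\bar D^1_{\dot2}-i\bar D^2_{\dot1})\,dv^2+(-\bar D^1_{\dot1}-\bar D^2_{\dot2})\,dv^3+(i\bar D^1_{\dot1}-i\bar D^2_{\dot2})\,dv^4 ,$$ with horizontal lifts $\mathcal D_0,\mathcal D_1$. In the twisted theory the bracket of odd operators is $[A,B]=\tfrac12(AB+BA)$, and $\epsilon_0$ is the metric trace of the two form indices. Put $$\Phi=-[\mathcal D_0,\mathcal D_0],\qquad \bar\Phi=-\tfrac14\,\epsilon_0[\mathcal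 D_1,\mathcal D_1],\qquad \phi=i^*\Phi,\qquad \bar\phi=i^*\bar\Phi .$$ **Proposition.** If $\mathcal A$ is semi-constrained, then, as endomorphisms of the associated bundle, $\Phi=\bar\Sigma$, and for either reading of $\bar D^a_{\dot b}$ also $\bar\Phi=\Sigma$ (in particular $\Phi$ and $\bar\Phi$ act as matrices of superfunctions, without derivatives). Consequently $\phi=\bar\sigma$ and $\bar\phi=\sigma$. -/

import Mathlib

open scoped Matrix TensorProduct ContDiff

noncomputable section

namespace TwistedSUSY

/-! ## Smooth complex functions on an open subset of Euclidean four-space -/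

/-- Euclidean four-space `V = E⁴`, in the coordinates `x¹, …, x⁴` of the orthonormal basis
`v₁, …, v₄` (numbered `0, …, 3` here). -/
abbrev E4 : Type := EuclideanSpace ℝ (Fin 4)

/-- Extension by zero of a function on `U`; only its values on the open set `U` are ever used. -/
def ext (U : TopologicalSpace.Opens E4) (f : U → ℂ) : E4 → ℂ :=
  Function.extend Subtype.val f 0

theorem ext_coe (U : TopologicalSpace.Opens E4) (f : U → ℂ) (x : U) : ext U f x = f x :=
  Subtype.val_injective.extend_apply f 0 x

theorem ext_add (U : TopologicalSpace.Opens E4) (f g : U → ℂ) :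
    ext U (f + g) = ext U f + ext U g := by
  unfold ext
  rw [← Function.extend_add, add_zero]

theorem ext_mul (U : TopologicalSpace.Opens E4) (f g : U → ℂ) :
    ext U (f * g) = ext U f * ext U g := by
  unfold ext
  rw [← Function.extend_mul, mul_zero]

theorem ext_smul (U : TopologicalSpace.Opens E4) (c : ℂ) (f : U → ℂ) :
    ext U (c • f) = c • ext U f := by
  unfold ext
  rw [← Function.extend_smul, smul_zero]

/-- The algebra `C^∞(U, ℂ)`. -/
def SmoothFun (U : TopologicalSpace.Opens E4) : Subalgebra ℂ (U → ℂ) where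
  carrier := {f | ContDiffOn ℝ ∞ (ext U f) U}
  mul_mem' := by
    intro f g hf hg
    simp only [Set.mem_ofPred_eq] at *
    rw [ext_mul]
    exact hf.mul hg
  add_mem' := by
    intro f g hf hg
    simp only [Set.mem_ofPred_eq] at *
    rw [ext_add]
    exact hf.add hg
  algebraMap_mem' := by
    intro c
    refine (contDiffOn_const (c := c)).congr ?_
    intro x hx
    exact ext_coe U _ ⟨x, hx⟩

theorem differentiableAt_ext {U : TopologicalSpace.Opens E4} (f : SmoothFun U) (x : U) :
    DifferentiableAt ℝ (ext U f) x :=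
  (f.2.contDiffAt (U.isOpen.mem_nhds x.2)).differentiableAt (by simp)

/-- The partial derivative `∂/∂x^m` on `C^∞(U, ℂ)`. -/
def partialX (U : TopologicalSpace.Opens E4) (m : Fin 4) : SmoothFun U →ₗ[ℂ] SmoothFun U where
  toFun f := ⟨fun x => fderiv ℝ (ext U f) x (EuclideanSpace.single m 1), by
    have h : ContDiffOn ℝ ∞ (fderiv ℝ (ext U f)) U :=
      f.2.fderiv_of_isOpen U.isOpen (by simp)
    refine (h.clm_apply (contDiffOn_const (c := EuclideanSpace.single m (1 : ℝ)))).congr ?_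
    intro x hx
    exact ext_coe U _ ⟨x, hx⟩⟩
  map_add' f g := by
    apply Subtype.ext
    funext x
    change fderiv ℝ (ext U ((f : U → ℂ) + (g : U → ℂ))) x _ =
      fderiv ℝ (ext U f) x _ + fderiv ℝ (ext U g) x _
    rw [ext_add, fderiv_add (differentiableAt_ext f x) (differentiableAt_ext g x)]
    rfl
  map_smul' c f := by
    apply Subtype.ext
    funext x
    change fderiv ℝ (ext U (c • (f : U → ℂ))) x _ = c • fderiv ℝ (ext U f) x _
    rw [ext_smul, fderiv_const_smul (differentiableAt_ext f x)]
    rfl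

/-! ## The superspace `E^{4|8}` over `U` -/

/-- Labels of the eight odd directions: `inl (a, i)` is the undotted direction with spinor index
`a` on the `i`-th copy, `inr (a, i)` the dotted one.  The index values `1, 2` are `0, 1` here. -/
abbrev OddIdx : Type := (Fin 2 × Fin 2) ⊕ (Fin 2 × Fin 2)

/-- The Grassmann algebra on the eight odd coordinates and `N` auxiliary odd parameters. -/
abbrev Grassmann (N : ℕ) : Type := ExteriorAlgebra ℂ (OddIdx ⊕ Fin N → ℂ)

/-- The Grassmann algebra on the `N` auxiliary odd parameters alone. -/
abbrev ParamGrassmann (N : ℕ) : Type := ExteriorAlgebra ℂ (Fin N → ℂ)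

/-- Superfunctions on the part of `E^{4|8}` over `U`, depending on `N` auxiliary odd parameters. -/
abbrev SuperFun (U : TopologicalSpace.Opens E4) (N : ℕ) : Type :=
  SmoothFun U ⊗[ℂ] Grassmann N

instance (U : TopologicalSpace.Opens E4) (N : ℕ) : Ring (SuperFun U N) :=
  Algebra.TensorProduct.instRing

instance (U : TopologicalSpace.Opens E4) (N : ℕ) : AddCommGroup (SuperFun U N) :=
  (inferInstance : Ring (SuperFun U N)).toAddCommGroup

/-- Functions on the even part `U`, depending on the `N` auxiliary odd parameters. -/
abbrev BodyFun (U : TopologicalSpace.Opens E4) (N : ℕ) : Type :=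
  SmoothFun U ⊗[ℂ] ParamGrassmann N

/-- `f` is homogeneous of parity `p` (`0` even, `1` odd). -/
def HasParity {U : TopologicalSpace.Opens E4} {N : ℕ} (p : ℕ) (f : SuperFun U N) : Prop :=
  LinearMap.lTensor (SmoothFun U)
    (CliffordAlgebra.involute : Grassmann N →ₐ[ℂ] Grassmann N).toLinearMap f = (-1 : ℂ) ^ p • f

/-- Restriction `i*` to the even part: all eight odd coordinates are set to zero. -/
def restrict (U : TopologicalSpace.Opens E4) (N : ℕ) : SuperFun U N →ₐ[ℂ] BodyFun U N :=
  Algebra.TensorProduct.map (AlgHom.id ℂ (SmoothFun U))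
    (ExteriorAlgebra.map (LinearMap.funLeft ℂ ℂ (Sum.inr : Fin N → OddIdx ⊕ Fin N)))

/-- The underlying ordinary function: odd coordinates and odd parameters are set to zero. -/
def body (U : TopologicalSpace.Opens E4) (N : ℕ) : SuperFun U N →ₐ[ℂ] SmoothFun U :=
  (Algebra.TensorProduct.rid ℂ ℂ (SmoothFun U)).toAlgHom.comp
    (Algebra.TensorProduct.map (AlgHom.id ℂ (SmoothFun U))
      (ExteriorAlgebra.algebraMapInv : Grassmann N →ₐ[ℂ] ℂ))

/-- The odd coordinate function labelled `k`. -/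
def theta (U : TopologicalSpace.Opens E4) (N : ℕ) (k : OddIdx) : SuperFun U N :=
  (1 : SmoothFun U) ⊗ₜ ExteriorAlgebra.ι ℂ (Pi.single (Sum.inl k) (1 : ℂ))

/-- The (left) derivative with respect to the odd coordinate labelled `k`. -/
def dOdd (U : TopologicalSpace.Opens E4) (N : ℕ) (k : OddIdx) : Module.End ℂ (SuperFun U N) :=
  LinearMap.lTensor (SmoothFun U)
    (CliffordAlgebra.contractLeft (Q := (0 : QuadraticForm ℂ (OddIdx ⊕ Fin N → ℂ)))
      (LinearMap.proj (Sum.inl k)))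

/-- The derivative `∂/∂x^m` of superfunctions. -/
def dX (U : TopologicalSpace.Opens E4) (N : ℕ) (m : Fin 4) : Module.End ℂ (SuperFun U N) :=
  LinearMap.rTensor (Grassmann N) (partialX U m)

/-- The spinor basis `e_{ab}` of `V ⊗ ℂ`, written in the basis `v₁, …, v₄`; equivalently
`v₁ = e₁₁ + e₂₂`, `v₂ = i e₁₁ - i e₂₂`, `v₃ = e₁₂ - e₂₁`, `v₄ = i e₁₂ + i e₂₁`. -/
def spinBasis : Fin 2 → Fin 2 → Fin 4 → ℂ :=
  ![![![1 / 2, -(Complex.I / 2), 0, 0], ![0, 0, 1 / 2, -(Complex.I / 2)]],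
    ![![0, 0, -(1 / 2), -(Complex.I / 2)], ![1 / 2, Complex.I / 2, 0, 0]]]

/-- The derivative `∂_{ab}` in the direction `e_{ab}`. -/
def dSpin (U : TopologicalSpace.Opens E4) (N : ℕ) (a b : Fin 2) : Module.End ℂ (SuperFun U N) :=
  ∑ m, spinBasis a b m • dX U N m

/-- The left-invariant odd vector fields
`D_a^{(i)} = ∂_{a(i)} - θ̄^{b(i)} ∂_{ab}` and `D̄_a^{(i)} = ∂̄_{a(i)} - θ^{b(i)} ∂_{ba}`. -/
def D (U : TopologicalSpace.Opens E4) (N : ℕ) : OddIdx → Module.End ℂ (SuperFun U N)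
  | .inl (a, i) => dOdd U N (.inl (a, i)) -
      ∑ b, LinearMap.mulLeft ℂ (theta U N (.inr (b, i))) * dSpin U N a b
  | .inr (a, i) => dOdd U N (.inr (a, i)) -
      ∑ b, LinearMap.mulLeft ℂ (theta U N (.inl (b, i))) * dSpin U N b a

/-- Coefficients, in the basis `∂/∂x^m`, of the super Lie bracket of two of the odd fields:
`[D_a^{(i)}, D̄_b^{(j)}] = -2 δ^{ij} ∂_{ab}`, all other brackets being zero. -/
def oddBracket : OddIdx → OddIdx → Fin 4 → ℂ
  | .inl (a, i), .inr (b, j) => if i = j then (-2 : ℂ) • spinBasis a b else 0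
  | .inr (b, j), .inl (a, i) => if i = j then (-2 : ℂ) • spinBasis a b else 0
  | _, _ => 0

/-! ## Superconnections -/

/-- Sections of the vector bundle associated to the fundamental representation of `SU(2)`. -/
abbrev Sec (U : TopologicalSpace.Opens E4) (N : ℕ) : Type := Fin 2 → SuperFun U N

/-- `2 × 2` matrices of superfunctions. -/
abbrev Mat (U : TopologicalSpace.Opens E4) (N : ℕ) : Type :=
  Matrix (Fin 2) (Fin 2) (SuperFun U N)

/-- A superconnection on a (trivialised) principal `SU(2)`-bundle over the part of `E^{4|8}` over
`U`: the components of its one-form in the frame `∂/∂x^m`, `D_a^{(i)}`, `D̄_a^{(i)}`.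
Superfunctions are complex, the odd fibres having no real structure, so the components are
trace-free matrices; the induced connection on the underlying ordinary bundle is
`su(2)`-valued. -/
structure SuperConnection (U : TopologicalSpace.Opens E4) (N : ℕ) where
  even : Fin 4 → Mat U N
  odd : OddIdx → Mat U N
  even_parity : ∀ m r s, HasParity 0 (even m r s)
  odd_parity : ∀ k r s, HasParity 1 (odd k r s)
  even_trace : ∀ m, (even m).trace = 0
  odd_trace : ∀ k, (odd k).trace = 0
  even_body : ∀ m (x : U), ((even m).map fun f => (body U N f : U → ℂ) x)ᴴ =
    -((even m).map fun f => (body U N f : U → ℂ) x)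

/-- A matrix of superfunctions as an endomorphism of the associated bundle. -/
def act {U : TopologicalSpace.Opens E4} {N : ℕ} (M : Mat U N) : Module.End ℂ (Sec U N) where
  toFun ψ := M *ᵥ ψ
  map_add' ψ χ := Matrix.mulVec_add M ψ χ
  map_smul' c ψ := Matrix.mulVec_smul M c ψ

/-- The matrix of a bundle endomorphism: its columns are the images of the two basis sections. -/
def matrixOf {U : TopologicalSpace.Opens E4} {N : ℕ} (T : Module.End ℂ (Sec U N)) : Mat U N :=
  Matrix.of fun r s => T (Pi.single s 1) r

namespace SuperConnection

variable {U : TopologicalSpace.Opens E4} {N : ℕ}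

/-- The covariant derivative along `D_a^{(i)}` or `D̄_a^{(i)}`, that is, the action of its
horizontal lift on sections. -/
def cov (A : SuperConnection U N) (k : OddIdx) : Module.End ℂ (Sec U N) :=
  (D U N k).compLeft (Fin 2) + act (A.odd k)

/-- The horizontal lift of the odd vector field with constant coefficients `c` in the frame
`D_a^{(i)}`, `D̄_a^{(i)}`. -/
def lift (A : SuperConnection U N) (c : OddIdx → ℂ) : Module.End ℂ (Sec U N) :=
  ∑ k, c k • A.cov k

/-- The curvature along two of the odd vector fields,
`F(X, Y) = X A(Y) + Y A(X) + A(X) A(Y) + A(Y) A(X) - A([X, Y])`. -/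
def curvature (A : SuperConnection U N) (k l : OddIdx) : Mat U N :=
  (A.odd l).map (D U N k) + (A.odd k).map (D U N l) + A.odd k * A.odd l + A.odd l * A.odd k
    - ∑ m, oddBracket k l m • A.even m

/-- `Σ`, the curvature along `D̄₁^{(2)}` and `D̄₂^{(1)}`. -/
def Sig (A : SuperConnection U N) : Mat U N := A.curvature (.inr (0, 1)) (.inr (1, 0))

/-- `Σ̄`, the curvature along `D₁^{(2)}` and `D₂^{(1)}`. -/
def SigBar (A : SuperConnection U N) : Mat U N := A.curvature (.inl (0, 1)) (.inl (1, 0))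

/-- The scalar `σ = i* Σ`. -/
def sigma (A : SuperConnection U N) : Matrix (Fin 2) (Fin 2) (BodyFun U N) :=
  A.Sig.map (restrict U N)

/-- The scalar `σ̄ = i* Σ̄`. -/
def sigmaBar (A : SuperConnection U N) : Matrix (Fin 2) (Fin 2) (BodyFun U N) :=
  A.SigBar.map (restrict U N)

end SuperConnection

/-- The antisymmetric tensor with `ε₁₂ = 1`. -/
def eps : Fin 2 → Fin 2 → ℂ := ![![0, 1], ![-1, 0]]

/-- Semi-constrained superconnections: the odd-odd curvature vanishes apart from the two
independent components `Σ` and `Σ̄`, which are the `SU(2)`-invariant parts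
`[𝒟̄₁^{(2)}, 𝒟̄₂^{(1)}] = -[𝒟̄₂^{(2)}, 𝒟̄₁^{(1)}] = Σ` and
`[𝒟₁^{(2)}, 𝒟₂^{(1)}] = -[𝒟₂^{(2)}, 𝒟₁^{(1)}] = Σ̄`. -/
structure IsSemiConstrained {U : TopologicalSpace.Opens E4} {N : ℕ}
    (A : SuperConnection U N) : Prop where
  mixed : ∀ a i b j, A.curvature (.inl (a, i)) (.inr (b, j)) = 0
  undotted : ∀ a i b j,
    A.curvature (.inl (a, i)) (.inl (b, j)) = (-(eps a b * eps i j)) • A.SigBar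
  dotted : ∀ a i b j,
    A.curvature (.inr (a, i)) (.inr (b, j)) = (-(eps a b * eps i j)) • A.Sig

/-! ## The twist -/

/-- The bracket `[S, T] = (1/2) (S T - (-1)^{pq} T S)` of operators of parities `p`, `q`. -/
def bracket {M : Type*} [AddCommGroup M] [Module ℂ M] (p q : ℕ) (S T : Module.End ℂ M) :
    Module.End ℂ M :=
  (1 / 2 : ℂ) • (S * T - (-1 : ℂ) ^ (p * q) • (T * S))

/-- The trace `ε₀ : TX ⊗ TX → X × ℝ`, in the orthonormal frame. -/
def eps0 {M : Type*} [AddCommMonoid M] (T : Fin 4 → Fin 4 → M) : M := ∑ m, T m m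

/-- `D^a_b`: the copy label of `D_b^{(a)}` becomes an upper spinor index. -/
def Dul (a b : Fin 2) : OddIdx → ℂ := Pi.single (.inl (b, a)) 1

/-- `D̄^a_b`, the copy label of `D̄_b^{(a)}` becoming an upper spinor index as it stands. -/
def DbarUl (a b : Fin 2) : OddIdx → ℂ := Pi.single (.inr (b, a)) 1

/-- `D̄^a_b`, the copy label of `D̄_b^{(i)}` being taken as a lower spinor index and raised with
the inverse of `ε`, `e₁ ↦ -e²`, `e₂ ↦ e¹`. -/
def DbarRaised (a b : Fin 2) : OddIdx → ℂ :=
  ∑ i, eps a i • (Pi.single (.inr (b, i)) 1 : OddIdx → ℂ)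

/-- `D₀ = D^1_1 + D^2_2`. -/
def D0 : OddIdx → ℂ := Dul 0 0 + Dul 1 1

/-- The four components of the one-form valued odd vector field `D₁` in the basis `dv¹, …, dv⁴`,
in terms of the fields `B a b = D̄^a_b`. -/
def D1 (B : Fin 2 → Fin 2 → OddIdx → ℂ) : Fin 4 → OddIdx → ℂ :=
  ![B 0 1 - B 1 0,
    -(Complex.I • B 0 1) - Complex.I • B 1 0,
    -B 0 0 - B 1 1,
    Complex.I • B 0 0 - Complex.I • B 1 1]

namespace SuperConnection

variable {U : TopologicalSpace.Opens E4} {N : ℕ}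

/-- `Φ = -[𝒟₀, 𝒟₀]`. -/
def Phi (A : SuperConnection U N) : Module.End ℂ (Sec U N) :=
  -bracket 1 1 (A.lift D0) (A.lift D0)

/-- `Φ̄ = -(1/4) ε₀ [𝒟₁, 𝒟₁]`. -/
def PhiBar (A : SuperConnection U N) (B : Fin 2 → Fin 2 → OddIdx → ℂ) :
    Module.End ℂ (Sec U N) :=
  -((1 / 4 : ℂ) • eps0 fun m n => bracket 1 1 (A.lift (D1 B m)) (A.lift (D1 B n)))

/-- `φ = i* Φ`. -/
def phi (A : SuperConnection U N) : Matrix (Fin 2) (Fin 2) (BodyFun U N) :=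
  (matrixOf A.Phi).map (restrict U N)

/-- `φ̄ = i* Φ̄`. -/
def phiBar (A : SuperConnection U N) (B : Fin 2 → Fin 2 → OddIdx → ℂ) :
    Matrix (Fin 2) (Fin 2) (BodyFun U N) :=
  (matrixOf (A.PhiBar B)).map (restrict U N)

end SuperConnection

end TwistedSUSY

end

open scoped Matrix TensorProduct ContDiff

namespace TwistedSUSY

/-! ## Derivations of the algebra of smooth functions -/

/-! `D0` is purely undotted and `D1` purely dotted. Fields of one chirality anticommute: ∂/∂θ never
meets a θ̄ factor, odd coordinates anticommute and the ∂'s commute. For such a pair the first- and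
second-order terms of the anticommutator of covariant derivatives cancel, which leaves the matrix
`curvature`, with no ∂ and no even component (`cov_anticomm_of_flat`). This rests on `D_mul`: each
`D` is an odd derivation, so it changes sign when it passes the odd matrix `A.odd`.

The rest is quadratic algebra. In 𝒟₀² the squares vanish by the constraint and the cross term is
F(D₁⁽¹⁾, D₂⁽²⁾) = -Σ̄. In Σₘ 𝒟₁(vₘ)² the factors `Complex.I` cancel all squares, so Φ̄ = ½({B01,
B10} - {B00, B11}) for every `B` (`phiBar_eq_anticomm`). Under both readings of D̄ the
anticommutators are Σ and -Σ. Restriction `i*` then gives the flat statements, since `matrixOf`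
inverts `act`. -/

theorem partialX_apply (U : TopologicalSpace.Opens E4) (m : Fin 4) (f : SmoothFun U) (x : U) :
    (partialX U m f : U → ℂ) x = fderiv ℝ (ext U f) x (EuclideanSpace.single m 1) := rfl

theorem partialX_mul (U : TopologicalSpace.Opens E4) (m : Fin 4) (f g : SmoothFun U) :
    partialX U m (f * g) = partialX U m f * g + f * partialX U m g := by
  apply Subtype.ext
  funext x
  change fderiv ℝ (ext U ((f : U → ℂ) * (g : U → ℂ))) x _ =
    fderiv ℝ (ext U f) x _ * (g : U → ℂ) x + (f : U → ℂ) x * fderiv ℝ (ext U g) x _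
  rw [ext_mul, fderiv_mul (differentiableAt_ext f x) (differentiableAt_ext g x)]
  simp [ext_coe]
  ring

theorem partialX_comm (U : TopologicalSpace.Opens E4) (m n : Fin 4) (f : SmoothFun U) :
    partialX U m (partialX U n f) = partialX U n (partialX U m f) := by
  have key : ∀ (m n : Fin 4) (x : U), (partialX U m (partialX U n f) : U → ℂ) x =
      fderiv ℝ (fderiv ℝ (ext U f)) x (EuclideanSpace.single m 1) (EuclideanSpace.single n 1) := by
    intro m n x
    rw [partialX_apply]
    have hU : (U : Set E4) ∈ nhds (x : E4) := U.isOpen.mem_nhds x.2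
    -- The zero extension agrees with the derivative only on `U`; agreement near `x` suffices to
    -- differentiate again.
    have he : ext U (partialX U n f) =ᶠ[nhds (x : E4)]
        fun y => fderiv ℝ (ext U f) y (EuclideanSpace.single n 1) := by
      filter_upwards [hU] with y hy
      exact ext_coe U _ ⟨y, hy⟩
    have h : ContDiffOn ℝ ∞ (fderiv ℝ (ext U f)) U :=
      f.2.fderiv_of_isOpen U.isOpen (by simp)
    have hd : DifferentiableAt ℝ (fderiv ℝ (ext U f)) x :=
      (h.contDiffAt hU).differentiableAt (by simp)
    rw [he.fderiv_eq, fderiv_clm_apply hd (differentiableAt_const _)]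
    simp
  apply Subtype.ext
  funext x
  rw [key, key]
  have hs : IsSymmSndFDerivAt ℝ (ext U f) (x : E4) :=
    (f.2.contDiffAt (U.isOpen.mem_nhds x.2)).isSymmSndFDerivAt (by
      rw [minSmoothness_of_isRCLikeNormedField]
      exact WithTop.coe_le_coe.mpr le_top)
  exact hs _ _

/-! ## Signs in the Grassmann algebra -/

section Exterior

variable {V : Type*} [AddCommGroup V] [Module ℂ V]

/-- Contraction anticommutes past each vector factor of `x`; the accumulated sign is `involute`. -/
theorem contractLeft_exterior_mul (d : Module.Dual ℂ V) (x y : ExteriorAlgebra ℂ V) :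
    CliffordAlgebra.contractLeft (Q := (0 : QuadraticForm ℂ V)) d (x * y) =
      CliffordAlgebra.contractLeft (Q := (0 : QuadraticForm ℂ V)) d x * y +
        CliffordAlgebra.involute (Q := (0 : QuadraticForm ℂ V)) x *
          CliffordAlgebra.contractLeft (Q := (0 : QuadraticForm ℂ V)) d y := by
  induction x using CliffordAlgebra.left_induction with
  | algebraMap r => simp [CliffordAlgebra.contractLeft_algebraMap_mul]
  | add x z hx hz => simp only [add_mul, map_add, hx, hz]; abel
  | ι_mul x v hx =>
    rw [mul_assoc, CliffordAlgebra.contractLeft_ι_mul, hx, CliffordAlgebra.contractLeft_ι_mul,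
      map_mul, CliffordAlgebra.involute_ι]
    simp only [mul_add, sub_mul, smul_mul_assoc, neg_mul, mul_assoc]
    abel

theorem exterior_ι_mul (v : V) (x : ExteriorAlgebra ℂ V) :
    ExteriorAlgebra.ι ℂ v * x =
      CliffordAlgebra.involute (Q := (0 : QuadraticForm ℂ V)) x * ExteriorAlgebra.ι ℂ v := by
  induction x using CliffordAlgebra.left_induction with
  | algebraMap r =>
    rw [AlgHom.commutes]
    exact (Algebra.commutes r _).symm
  | add x z hx hz => simp only [mul_add, map_add, add_mul, hx, hz]
  | ι_mul x w hx =>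
    have h : ExteriorAlgebra.ι ℂ v * ExteriorAlgebra.ι ℂ w =
        -(ExteriorAlgebra.ι ℂ w * ExteriorAlgebra.ι ℂ v) :=
      eq_neg_of_add_eq_zero_left (ExteriorAlgebra.ι_add_mul_swap v w)
    rw [map_mul, CliffordAlgebra.involute_ι, neg_mul, neg_mul, mul_assoc, ← hx, ← mul_assoc,
      ← mul_assoc]
    exact (congrArg (· * x) h).trans (neg_mul _ _)

end Exterior

/-! ## The odd vector fields as derivations of superfunctions -/

variable (U : TopologicalSpace.Opens E4) (N : ℕ)

/-- The grading involution of the algebra of superfunctions. -/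
def parity : SuperFun U N →ₗ[ℂ] SuperFun U N :=
  LinearMap.lTensor (SmoothFun U)
    (CliffordAlgebra.involute : Grassmann N →ₐ[ℂ] Grassmann N).toLinearMap

theorem dOdd_mul (k : OddIdx) (f g : SuperFun U N) :
    dOdd U N k (f * g) = dOdd U N k f * g + parity U N f * dOdd U N k g := by
  induction f using TensorProduct.induction_on with
  | zero => simp
  | add f₁ f₂ h₁ h₂ => simp only [add_mul, map_add, h₁, h₂]; abel
  | tmul a x =>
    induction g using TensorProduct.induction_on with
    | zero => simp
    | add g₁ g₂ h₁ h₂ => simp only [mul_add, map_add, h₁, h₂]; abel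
    | tmul b y =>
      simp only [dOdd, parity, Algebra.TensorProduct.tmul_mul_tmul, LinearMap.lTensor_tmul,
        AlgHom.toLinearMap_apply, contractLeft_exterior_mul, TensorProduct.tmul_add]

theorem dX_mul (m : Fin 4) (f g : SuperFun U N) :
    dX U N m (f * g) = dX U N m f * g + f * dX U N m g := by
  induction f using TensorProduct.induction_on with
  | zero => simp
  | add f₁ f₂ h₁ h₂ => simp only [add_mul, map_add, h₁, h₂]; abel
  | tmul a x =>
    induction g using TensorProduct.induction_on with
    | zero => simp
    | add g₁ g₂ h₁ h₂ => simp only [mul_add, map_add, h₁, h₂]; abel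
    | tmul b y =>
      simp only [dX, Algebra.TensorProduct.tmul_mul_tmul, LinearMap.rTensor_tmul, partialX_mul,
        TensorProduct.add_tmul]

theorem dX_comm (m n : Fin 4) (f : SuperFun U N) :
    dX U N m (dX U N n f) = dX U N n (dX U N m f) := by
  induction f using TensorProduct.induction_on with
  | zero => simp
  | add f₁ f₂ h₁ h₂ => simp only [map_add, h₁, h₂]
  | tmul a x => simp only [dX, LinearMap.rTensor_tmul, partialX_comm U m n]

theorem dOdd_dX (k : OddIdx) (m : Fin 4) (f : SuperFun U N) :
    dOdd U N k (dX U N m f) = dX U N m (dOdd U N k f) := by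
  induction f using TensorProduct.induction_on with
  | zero => simp
  | add f₁ f₂ h₁ h₂ => simp only [map_add, h₁, h₂]
  | tmul a x => simp only [dX, dOdd, LinearMap.rTensor_tmul, LinearMap.lTensor_tmul]

theorem dOdd_anticomm (k l : OddIdx) (f : SuperFun U N) :
    dOdd U N k (dOdd U N l f) = -dOdd U N l (dOdd U N k f) := by
  induction f using TensorProduct.induction_on with
  | zero => simp
  | add f₁ f₂ h₁ h₂ => simp only [map_add, h₁, h₂]; abel
  | tmul a x =>
    simp only [dOdd, LinearMap.lTensor_tmul]
    rw [CliffordAlgebra.contractLeft_comm, TensorProduct.tmul_neg]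

theorem theta_mul (k : OddIdx) (f : SuperFun U N) :
    theta U N k * f = parity U N f * theta U N k := by
  induction f using TensorProduct.induction_on with
  | zero => simp
  | add f₁ f₂ h₁ h₂ => simp only [mul_add, add_mul, map_add, h₁, h₂]
  | tmul a x =>
    simp only [theta, parity, Algebra.TensorProduct.tmul_mul_tmul, LinearMap.lTensor_tmul,
      AlgHom.toLinearMap_apply, one_mul, mul_one, exterior_ι_mul]

theorem parity_theta (k : OddIdx) : parity U N (theta U N k) = -theta U N k := by
  simp only [theta, parity, LinearMap.lTensor_tmul, AlgHom.toLinearMap_apply]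
  rw [← TensorProduct.tmul_neg]
  exact congrArg _ (CliffordAlgebra.involute_ι _)

theorem dOdd_theta {k l : OddIdx} (h : k ≠ l) : dOdd U N k (theta U N l) = 0 := by
  simp only [theta, dOdd, LinearMap.lTensor_tmul]
  have := CliffordAlgebra.contractLeft_ι (Q := (0 : QuadraticForm ℂ (OddIdx ⊕ Fin N → ℂ)))
    (LinearMap.proj (Sum.inl k)) (Pi.single (Sum.inl l) (1 : ℂ))
  refine (congrArg _ this).trans ?_
  simp [h]

theorem dX_theta (m : Fin 4) (l : OddIdx) : dX U N m (theta U N l) = 0 := by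
  have h : partialX U m 1 = 0 := by
    -- Leibniz on 1 · 1 gives ∂1 = ∂1 + ∂1.
    have := partialX_mul U m 1 1
    simpa using this
  simp only [theta, dX, LinearMap.rTensor_tmul, h, TensorProduct.zero_tmul]

variable {U N}

theorem dSpin_apply (a b : Fin 2) (f : SuperFun U N) :
    dSpin U N a b f = ∑ m, spinBasis a b m • dX U N m f := by
  simp [dSpin]

theorem dSpin_mul (a b : Fin 2) (f g : SuperFun U N) :
    dSpin U N a b (f * g) = dSpin U N a b f * g + f * dSpin U N a b g := by
  simp only [dSpin_apply, dX_mul, smul_add, Finset.sum_add_distrib, Finset.sum_mul, Finset.mul_sum,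
    smul_mul_assoc, mul_smul_comm]

theorem dSpin_theta_mul (a b : Fin 2) (k : OddIdx) (f : SuperFun U N) :
    dSpin U N a b (theta U N k * f) = theta U N k * dSpin U N a b f := by
  rw [dSpin_mul, dSpin_apply a b (theta U N k)]
  simp [dX_theta]

theorem dSpin_comm (a b c d : Fin 2) (f : SuperFun U N) :
    dSpin U N a b (dSpin U N c d f) = dSpin U N c d (dSpin U N a b f) := by
  simp only [dSpin_apply, map_sum, map_smul, Finset.smul_sum]
  rw [Finset.sum_comm]
  refine Finset.sum_congr rfl fun m _ => Finset.sum_congr rfl fun n _ => ?_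
  rw [dX_comm, smul_comm]

theorem dOdd_dSpin (k : OddIdx) (a b : Fin 2) (f : SuperFun U N) :
    dOdd U N k (dSpin U N a b f) = dSpin U N a b (dOdd U N k f) := by
  simp only [dSpin_apply, map_sum, map_smul, dOdd_dX]

theorem dOdd_theta_mul {k l : OddIdx} (h : k ≠ l) (f : SuperFun U N) :
    dOdd U N k (theta U N l * f) = -(theta U N l * dOdd U N k f) := by
  rw [dOdd_mul, dOdd_theta U N h, parity_theta, zero_mul, zero_add, neg_mul]

theorem theta_theta_mul (k l : OddIdx) (f : SuperFun U N) :
    theta U N k * (theta U N l * f) = -(theta U N l * (theta U N k * f)) := by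
  rw [← mul_assoc, theta_mul, parity_theta, neg_mul, neg_mul, mul_assoc]

theorem D_inl_apply (a i : Fin 2) (f : SuperFun U N) :
    D U N (.inl (a, i)) f = dOdd U N (.inl (a, i)) f -
      ∑ b, theta U N (.inr (b, i)) * dSpin U N a b f := by
  simp [D]

theorem D_inr_apply (a i : Fin 2) (f : SuperFun U N) :
    D U N (.inr (a, i)) f = dOdd U N (.inr (a, i)) f -
      ∑ b, theta U N (.inl (b, i)) * dSpin U N b a f := by
  simp [D]

/-- An even derivation becomes odd after left multiplication by θ: moving θ past `f` produces
`parity`. -/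
theorem theta_dSpin_leibniz (k : OddIdx) (a b : Fin 2) (f g : SuperFun U N) :
    theta U N k * dSpin U N a b (f * g) =
      theta U N k * dSpin U N a b f * g + parity U N f * (theta U N k * dSpin U N a b g) := by
  rw [dSpin_mul, mul_add, ← mul_assoc, ← mul_assoc, ← mul_assoc, theta_mul U N k f]

/-- The odd vector fields are odd derivations. -/
theorem D_mul (k : OddIdx) (f g : SuperFun U N) :
    D U N k (f * g) = D U N k f * g + parity U N f * D U N k g := by
  rcases k with ⟨a, i⟩ | ⟨a, i⟩
  · simp only [D_inl_apply, dOdd_mul, theta_dSpin_leibniz, Finset.sum_add_distrib, sub_mul, mul_sub,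
      Finset.sum_mul, Finset.mul_sum]
    abel
  · simp only [D_inr_apply, dOdd_mul, theta_dSpin_leibniz, Finset.sum_add_distrib, sub_mul, mul_sub,
      Finset.sum_mul, Finset.mul_sum]
    abel

theorem D_inl_anticomm (p q : Fin 2 × Fin 2) (f : SuperFun U N) :
    D U N (.inl p) (D U N (.inl q) f) = -D U N (.inl q) (D U N (.inl p) f) := by
  obtain ⟨a, i⟩ := p
  obtain ⟨b, j⟩ := q
  have h : ∀ (p q : Fin 2 × Fin 2), (Sum.inl p : OddIdx) ≠ Sum.inr q := fun _ _ => Sum.inl_ne_inr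
  simp only [D_inl_apply, map_sub, map_sum, dOdd_theta_mul (h _ _), dSpin_theta_mul, dOdd_dSpin,
    Finset.sum_sub_distrib, Finset.sum_neg_distrib]
  -- The θ̄θ̄∂∂ term is antisymmetric: the θ̄'s anticommute and the ∂'s commute, once the summation
  -- indices are swapped.
  have e : ∑ c : Fin 2, ∑ d : Fin 2, theta U N (.inr (d, i)) * (theta U N (.inr (c, j)) *
        dSpin U N a d (dSpin U N b c f)) =
      -∑ c : Fin 2, ∑ d : Fin 2, theta U N (.inr (d, j)) * (theta U N (.inr (c, i)) *
        dSpin U N b d (dSpin U N a c f)) := by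
    rw [Finset.sum_comm]
    simp only [← Finset.sum_neg_distrib]
    refine Finset.sum_congr rfl fun c _ => Finset.sum_congr rfl fun d _ => ?_
    rw [theta_theta_mul, dSpin_comm]
  rw [e, dOdd_anticomm]
  abel

theorem D_inr_anticomm (p q : Fin 2 × Fin 2) (f : SuperFun U N) :
    D U N (.inr p) (D U N (.inr q) f) = -D U N (.inr q) (D U N (.inr p) f) := by
  obtain ⟨a, i⟩ := p
  obtain ⟨b, j⟩ := q
  have h : ∀ (p q : Fin 2 × Fin 2), (Sum.inr p : OddIdx) ≠ Sum.inl q := fun _ _ => Sum.inr_ne_inl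
  simp only [D_inr_apply, map_sub, map_sum, dOdd_theta_mul (h _ _), dSpin_theta_mul, dOdd_dSpin,
    Finset.sum_sub_distrib, Finset.sum_neg_distrib]
  have e : ∑ c : Fin 2, ∑ d : Fin 2, theta U N (.inl (d, i)) * (theta U N (.inl (c, j)) *
        dSpin U N d a (dSpin U N c b f)) =
      -∑ c : Fin 2, ∑ d : Fin 2, theta U N (.inl (d, j)) * (theta U N (.inl (c, i)) *
        dSpin U N d b (dSpin U N c a f)) := by
    rw [Finset.sum_comm]
    simp only [← Finset.sum_neg_distrib]
    refine Finset.sum_congr rfl fun c _ => Finset.sum_congr rfl fun d _ => ?_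
    rw [theta_theta_mul, dSpin_comm]
  rw [e, dOdd_anticomm]
  abel

/-! ## Anticommutators of the covariant derivatives -/

theorem act_apply (M : Mat U N) (ψ : Sec U N) : act M ψ = M *ᵥ ψ := rfl

theorem act_smul (c : ℂ) (M : Mat U N) : act (c • M) = c • act M := by
  refine LinearMap.ext fun ψ => ?_
  exact Matrix.smul_mulVec c M ψ

theorem matrixOf_act (M : Mat U N) : matrixOf (act M) = M := by
  ext r s
  simp [matrixOf, act_apply]

namespace SuperConnection

variable (A : SuperConnection U N)

theorem parity_odd (k : OddIdx) (r s : Fin 2) : parity U N (A.odd k r s) = -A.odd k r s := by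
  have h := A.odd_parity k r s
  rw [HasParity, pow_one, neg_one_smul] at h
  exact h

theorem D_act_odd (k l : OddIdx) (ψ : Sec U N) :
    (D U N k).compLeft (Fin 2) (act (A.odd l) ψ) =
      act ((A.odd l).map (D U N k)) ψ - act (A.odd l) ((D U N k).compLeft (Fin 2) ψ) := by
  ext1 r
  simp only [act_apply, LinearMap.compLeft_apply, Matrix.mulVec, dotProduct, Pi.sub_apply,
    Function.comp_apply, map_sum, D_mul, parity_odd, neg_mul, Matrix.map_apply,
    Finset.sum_add_distrib, Finset.sum_neg_distrib]
  abel

/-- By `D_act_odd`, the first-order terms A(X)Y and A(Y)X each appear with both signs; the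
second-order terms cancel by `hD`. -/
theorem cov_anticomm_of_flat {k l : OddIdx} (hb : oddBracket k l = 0)
    (hD : ∀ f : SuperFun U N, D U N k (D U N l f) = -D U N l (D U N k f)) :
    A.cov k * A.cov l + A.cov l * A.cov k = act (A.curvature k l) := by
  refine LinearMap.ext fun ψ => ?_
  have h : (D U N k).compLeft (Fin 2) ((D U N l).compLeft (Fin 2) ψ) =
      -(D U N l).compLeft (Fin 2) ((D U N k).compLeft (Fin 2) ψ) := by
    ext1 r
    exact hD (ψ r)
  simp only [cov, LinearMap.add_apply, Module.End.mul_apply, map_add, D_act_odd, h, curvature, hb]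
  simp only [act_apply, Pi.zero_apply, zero_smul, Finset.sum_const_zero, sub_zero,
    Matrix.add_mulVec, Matrix.mulVec_mulVec]
  abel

theorem cov_inl_anticomm (p q : Fin 2 × Fin 2) :
    A.cov (.inl p) * A.cov (.inl q) + A.cov (.inl q) * A.cov (.inl p) =
      act (A.curvature (.inl p) (.inl q)) :=
  A.cov_anticomm_of_flat rfl (D_inl_anticomm p q)

theorem cov_inr_anticomm (p q : Fin 2 × Fin 2) :
    A.cov (.inr p) * A.cov (.inr q) + A.cov (.inr q) * A.cov (.inr p) =
      act (A.curvature (.inr p) (.inr q)) :=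
  A.cov_anticomm_of_flat rfl (D_inr_anticomm p q)

/-! ## Horizontal lifts -/

theorem lift_add (c d : OddIdx → ℂ) : A.lift (c + d) = A.lift c + A.lift d := by
  simp [lift, add_smul, Finset.sum_add_distrib]

theorem lift_smul (z : ℂ) (c : OddIdx → ℂ) : A.lift (z • c) = z • A.lift c := by
  simp [lift, mul_smul, Finset.smul_sum]

theorem lift_neg (c : OddIdx → ℂ) : A.lift (-c) = (-1 : ℂ) • A.lift c := by
  rw [← lift_smul, neg_one_smul]

theorem lift_sub (c d : OddIdx → ℂ) : A.lift (c - d) = A.lift c + (-1 : ℂ) • A.lift d := by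
  rw [sub_eq_add_neg, lift_add, lift_neg]

theorem lift_single (k : OddIdx) : A.lift (Pi.single k 1) = A.cov k := by
  simp [lift, Pi.single_apply]

end SuperConnection

/-! ### Expansion of Φ̄ into anticommutators. -/

theorem bracket_one_one_self {M : Type*} [AddCommGroup M] [Module ℂ M] (S : Module.End ℂ M) :
    bracket 1 1 S S = S * S := by
  simp only [bracket, mul_one, pow_one, neg_one_smul, sub_neg_eq_add]
  module

namespace SuperConnection

variable (A : SuperConnection U N)

theorem phiBar_eq_anticomm (B : Fin 2 → Fin 2 → OddIdx → ℂ) :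
    A.PhiBar B = (1 / 2 : ℂ) •
      ((A.lift (B 0 1) * A.lift (B 1 0) + A.lift (B 1 0) * A.lift (B 0 1)) -
        (A.lift (B 0 0) * A.lift (B 1 1) + A.lift (B 1 1) * A.lift (B 0 0))) := by
  simp only [PhiBar, eps0, bracket_one_one_self, Fin.sum_univ_four, D1, Matrix.cons_val,
    lift_sub, lift_neg, lift_smul]
  simp only [mul_add, add_mul, smul_mul_assoc, mul_smul_comm, smul_smul, smul_add]
  -- Collecting the scalars exposes `Complex.I ^ 2`; its value -1 makes the squares cancel between
  -- components 1, 2 and between 3, 4.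
  ring_nf
  simp only [Complex.I_sq]
  module

end SuperConnection

/-! ### Evaluation under the curvature constraints. -/

namespace IsSemiConstrained

variable {A : SuperConnection U N}

theorem cov_undotted (hA : IsSemiConstrained A) (a i b j : Fin 2) :
    A.cov (.inl (a, i)) * A.cov (.inl (b, j)) + A.cov (.inl (b, j)) * A.cov (.inl (a, i)) =
      (-(eps a b * eps i j)) • act A.SigBar := by
  rw [A.cov_inl_anticomm, hA.undotted, act_smul]

theorem cov_dotted (hA : IsSemiConstrained A) (a i b j : Fin 2) :
    A.cov (.inr (a, i)) * A.cov (.inr (b, j)) + A.cov (.inr (b, j)) * A.cov (.inr (a, i)) =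
      (-(eps a b * eps i j)) • act A.Sig := by
  rw [A.cov_inr_anticomm, hA.dotted, act_smul]

/-- Twice the square is a self-anticommutator, which carries the factor `eps a a = 0`. -/
theorem cov_undotted_sq (hA : IsSemiConstrained A) (a i : Fin 2) : A.cov (.inl (a, i)) * A.cov (.inl (a, i)) = 0 := by
  have h := hA.cov_undotted a i a i
  have he : eps a a = 0 := by fin_cases a <;> simp [eps]
  rw [he, zero_mul, neg_zero, zero_smul, ← two_smul ℂ] at h
  exact (smul_eq_zero.mp h).resolve_left two_ne_zero

theorem Phi_eq (hA : IsSemiConstrained A) : A.Phi = act A.SigBar := by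
  have h := hA.cov_undotted 0 0 1 1
  simp only [eps, Matrix.cons_val, mul_one] at h
  rw [SuperConnection.Phi, bracket_one_one_self, D0, Dul, Dul, A.lift_add, A.lift_single,
    A.lift_single, mul_add, add_mul, add_mul, hA.cov_undotted_sq, hA.cov_undotted_sq, zero_add,
    add_zero, add_comm, h]
  module

theorem PhiBar_DbarUl (hA : IsSemiConstrained A) : A.PhiBar DbarUl = act A.Sig := by
  have h := hA.cov_dotted 1 0 0 1
  have h' := hA.cov_dotted 0 0 1 1
  simp only [eps, Matrix.cons_val] at h h'
  rw [A.phiBar_eq_anticomm]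
  simp only [DbarUl, A.lift_single]
  rw [h, h']
  module

/-- Raising the label exchanges the two anticommutators of `phiBar_eq_anticomm` with a sign each, so
their difference is the same as for `DbarUl`. -/
theorem PhiBar_DbarRaised (hA : IsSemiConstrained A) : A.PhiBar DbarRaised = act A.Sig := by
  have h := hA.cov_dotted 1 1 0 0
  have h' := hA.cov_dotted 0 1 1 0
  simp only [eps, Matrix.cons_val] at h h'
  have h0 : ∀ b, A.lift (DbarRaised 0 b) = A.cov (.inr (b, 1)) := fun b => by
    simp [DbarRaised, eps, A.lift_single]
  have h1 : ∀ b, A.lift (DbarRaised 1 b) =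
      (-1 : ℂ) • A.cov (.inr (b, 0)) := fun b => by
    simp only [DbarRaised, eps, Fin.sum_univ_two, Matrix.cons_val, zero_smul, add_zero,
      A.lift_smul, A.lift_single]
  rw [A.phiBar_eq_anticomm]
  simp only [h0, h1, mul_smul_comm, smul_mul_assoc, ← smul_add]
  rw [h, h']
  module

end IsSemiConstrained

end TwistedSUSY

theorem mainTheorem10 (U : TopologicalSpace.Opens TwistedSUSY.E4) (N : ℕ)
    (A : TwistedSUSY.SuperConnection U N) (hA : TwistedSUSY.IsSemiConstrained A) :
    A.Phi = TwistedSUSY.act A.SigBar ∧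
    A.phi = A.sigmaBar ∧
    (∀ B : Fin 2 → Fin 2 → TwistedSUSY.OddIdx → ℂ,
      B = TwistedSUSY.DbarUl ∨ B = TwistedSUSY.DbarRaised →
        A.PhiBar B = TwistedSUSY.act A.Sig ∧
        A.phiBar B = A.sigma) := by
  refine ⟨hA.Phi_eq, ?_, ?_⟩
  · rw [TwistedSUSY.SuperConnection.phi, hA.Phi_eq, TwistedSUSY.matrixOf_act]
    rfl
  · intro B hB
    have h : A.PhiBar B = TwistedSUSY.act A.Sig := by
      rcases hB with rfl | rfl
      · exact hA.PhiBar_DbarUl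
      · exact hA.PhiBar_DbarRaised
    refine ⟨h, ?_⟩
    rw [TwistedSUSY.SuperConnection.phiBar, h, TwistedSUSY.matrixOf_act]
    rfl
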